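/- Let $d\ge 1$ be an integer and let $\mathcal{C}$ be a finite family of at least $d(d+3)/2$ convex sets in $\mathbb{R}^d$. By an ellipsoid in $\mathbb{R}^d$ we mean the image of the closed Euclidean unit ball under an invertible affine map of $\mathbb{R}^d$. Assume that for any selection of $d(d+3)/2$ members $C_1,\dots,C_{d(d+3)/2}$ of $\mathcal{C}$, the intersection $\bigcap_{i=1}^{d(d+3)/2} C_i$ contains an ellipsoid of volume $1$. Then $\bigcap_{C\in\mathcal{C}} C$ also contains an ellipsoid of volume $1$. -/

import Mathlib

open MeasureTheory

/-- An ellipsoid in `ℝ^d`: the image of the closed Euclidean unit ball under an invertible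
affine map. -/
def IsEllipsoid {d : ℕ} (E : Set (EuclideanSpace ℝ (Fin d))) : Prop :=
  ∃ A : EuclideanSpace ℝ (Fin d) ≃ᵃ[ℝ] EuclideanSpace ℝ (Fin d),
    E = A '' Metric.closedBall (0 : EuclideanSpace ℝ (Fin d)) 1

/-- The set `K` contains an ellipsoid of (Lebesgue) volume `1`. -/
def ContainsUnitVolumeEllipsoid {d : ℕ} (K : Set (EuclideanSpace ℝ (Fin d))) : Prop :=
  ∃ E : Set (EuclideanSpace ℝ (Fin d)), IsEllipsoid E ∧ volume E = 1 ∧ E ⊆ K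

/-!
Every ellipsoid is `P B + b` with `B` the unit ball, `P` a positive semidefinite matrix and `b` its
centre (polar decomposition, `Matrix.exists_posSemidef_eq_mul_unitary`). The pairs `(P, b)` with
`P` symmetric form a space of dimension `d (d + 1) / 2 + d = d (d + 3) / 2`, written `h` below.
In it, two kinds of sets are convex:

* for a convex set `C`, the pairs with `P B + b ⊆ C`, where `P` may be degenerate
  (`convex_paramsInside`);
* the pairs with `P` positive semidefinite and `P B` of volume at least `1`, because the
  determinant is log-concave (`convex_largeParams`, from `Matrix.PosDef.rpow_det_mul_rpow_det_le`).

Helly's theorem, applied to the sets of the first kind, one for each member of the family, together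
with the one set of the second kind, asks that any `h + 1` of them have a common point.
If the volume condition is among them, only `h` members of the family are involved, and the
hypothesis gives the point. If it is not, degenerate ellipsoids are allowed and a common point `z`
of all members of the family will do, as the pair `(0, z)`; it exists by Helly's theorem in `ℝ^d`,
since `d + 1 ≤ h`. This is why `h` rather than `h + 1` members suffice. A common point of all these
sets is an ellipsoid of volume at least `1` inside every member, and it is shrunk to volume `1`
(`containsUnitVolumeEllipsoid_of_unitDet_le`).
-/

open scoped MatrixOrder Matrix

namespace Matrix

/-! ### Symmetric matrices as functions on unordered pairs -/

/-- The symmetric matrix whose entry at `i`, `j` is the value of `f` at the unordered pair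
`{i, j}`. -/
def ofSym2 {n : Type*} : (Sym2 n → ℝ) →ₗ[ℝ] Matrix n n ℝ where
  toFun f := of fun i j => f s(i, j)
  map_add' _ _ := rfl
  map_smul' _ _ := rfl

theorem IsHermitian.exists_ofSym2_eq {n : Type*} {P : Matrix n n ℝ} (hP : P.IsHermitian) :
    ∃ f, ofSym2 f = P := by
  refine ⟨Sym2.lift ⟨fun i j => P i j, fun i j => ?_⟩, ?_⟩
  · simpa using (hP.apply i j).symm
  · ext i j; rfl

/-! ### Convexity of the positive semidefinite matrices of large determinant -/

variable {n : Type*} [Fintype n] [DecidableEq n]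

/-- The case of `PosDef.rpow_det_mul_rpow_det_le` where one of the matrices is the identity: the
weighted AM-GM inequality for each eigenvalue. -/
theorem PosDef.rpow_det_le_det_smul_one_add_smul {D : Matrix n n ℝ} (hD : D.PosDef) {a b : ℝ}
    (ha : 0 ≤ a) (hb : 0 ≤ b) (hab : a + b = 1) :
    D.det ^ b ≤ (a • (1 : Matrix n n ℝ) + b • D).det := by
  have key : (a • (1 : Matrix n n ℝ) + b • D).det = ∏ i, (a + b * hD.1.eigenvalues i) := by
    have h1 : a • (1 : Matrix n n ℝ) + b • D =
        Unitary.conjStarAlgAut ℝ _ hD.1.eigenvectorUnitary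
          (diagonal fun i => a + b * hD.1.eigenvalues i) := by
      have h2 : (diagonal fun i => a + b * hD.1.eigenvalues i) =
          a • (1 : Matrix n n ℝ) + b • diagonal (RCLike.ofReal ∘ hD.1.eigenvalues) := by
        ext i j
        rcases eq_or_ne i j with rfl | h
        · simp
        · simp [h]
      rw [h2, map_add, map_smul, map_smul, map_one, ← hD.1.spectral_theorem]
    rw [h1, Unitary.conjStarAlgAut_apply, det_mul_comm, ← mul_assoc]
    simp [det_diagonal]
  rw [key, hD.1.det_eq_prod_eigenvalues, ← Real.finsetProd_rpow]
  · refine Finset.prod_le_prod (fun i _ => by have := hD.eigenvalues_pos i; positivity)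
      fun i _ => ?_
    have := Real.geom_mean_le_arith_mean2_weighted ha hb zero_le_one (hD.eigenvalues_pos i).le hab
    simpa using this
  · exact fun i _ => (hD.eigenvalues_pos i).le

/-- The determinant is log-concave on positive definite matrices: writing `A = Sᴴ S`, the
congruence by `S⁻¹` takes `A` to the identity and multiplies all determinants by `1 / det A`. -/
theorem PosDef.rpow_det_mul_rpow_det_le {A B : Matrix n n ℝ} (hA : A.PosDef) (hB : B.PosDef)
    {a b : ℝ} (ha : 0 ≤ a) (hb : 0 ≤ b) (hab : a + b = 1) :
    A.det ^ a * B.det ^ b ≤ (a • A + b • B).det := by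
  obtain ⟨S, hS⟩ := CStarAlgebra.nonneg_iff_eq_star_mul_self.mp hA.posSemidef.nonneg
  rw [star_eq_conjTranspose] at hS
  have hdetA : A.det = S.det * S.det := by
    rw [hS, det_mul, det_conjTranspose]; simp
  have hA0 := hA.det_pos
  have hS0 : IsUnit S.det := by
    rw [isUnit_iff_ne_zero]; rintro h; simp [hdetA, h] at hA0
  set D := (S⁻¹)ᴴ * B * S⁻¹ with hDdef
  have hD : D.PosDef := hB.conjTranspose_mul_mul_same
    (Matrix.mulVec_injective_iff_isUnit.mpr (by
      rw [isUnit_iff_isUnit_det]; exact isUnit_nonsing_inv_det S hS0))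
  have hSD : Sᴴ * D * S = B := by
    have h1 : Sᴴ * (S⁻¹)ᴴ = 1 := by
      rw [← conjTranspose_mul, nonsing_inv_mul _ hS0, conjTranspose_one]
    calc Sᴴ * D * S = (Sᴴ * (S⁻¹)ᴴ) * B * (S⁻¹ * S) := by simp only [hDdef, mul_assoc]
      _ = B := by rw [h1, nonsing_inv_mul _ hS0, one_mul, mul_one]
  have hsum : a • A + b • B = Sᴴ * (a • (1 : Matrix n n ℝ) + b • D) * S := by
    rw [mul_add, add_mul, mul_smul_comm, mul_smul_comm, smul_mul_assoc, smul_mul_assoc, hSD,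
      mul_one, ← hS]
  have hdetB : B.det = A.det * D.det := by
    rw [← hSD, det_mul, det_mul, det_conjTranspose, hdetA]; simp; ring
  have hdet : (a • A + b • B).det = A.det * (a • (1 : Matrix n n ℝ) + b • D).det := by
    rw [hsum, det_mul, det_mul, det_conjTranspose, hdetA]; simp; ring
  rw [hdet, hdetB, Real.mul_rpow hA0.le hD.det_pos.le, ← mul_assoc, ← Real.rpow_add hA0, hab,
    Real.rpow_one]
  exact mul_le_mul_of_nonneg_left (hD.rpow_det_le_det_smul_one_add_smul ha hb hab) hA0.le

theorem convex_posSemidef_le_det {c : ℝ} (hc : 0 < c) :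
    Convex ℝ {A : Matrix n n ℝ | A.PosSemidef ∧ c ≤ A.det} := by
  rintro A ⟨hA, hcA⟩ B ⟨hB, hcB⟩ a b ha hb hab
  refine ⟨(hA.smul ha).add (hB.smul hb), ?_⟩
  have hA' : A.PosDef := hA.posDef_iff_det_ne_zero.mpr (hc.trans_le hcA).ne'
  have hB' : B.PosDef := hB.posDef_iff_det_ne_zero.mpr (hc.trans_le hcB).ne'
  calc c = c ^ a * c ^ b := by rw [← Real.rpow_add hc, hab, Real.rpow_one]
    _ ≤ A.det ^ a * B.det ^ b := by
      have := hA'.det_pos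
      gcongr
    _ ≤ _ := hA'.rpow_det_mul_rpow_det_le hB' ha hb hab

/-! ### Polar decomposition -/

/-- Polar decomposition of an invertible matrix; the positive semidefinite factor is the square
root of `N Nᴴ`. -/
theorem exists_posSemidef_eq_mul_unitary {N : Matrix n n ℝ} (hN : IsUnit N.det) :
    ∃ P U : Matrix n n ℝ, P.PosSemidef ∧ U ∈ unitary (Matrix n n ℝ) ∧ P = N * U ∧
      P.det = |N.det| := by
  have hQ : (N * Nᴴ).PosSemidef := posSemidef_self_mul_conjTranspose N
  have hdet : (CFC.sqrt (N * Nᴴ)).det = |N.det| := by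
    rw [hQ.det_sqrt, det_mul, det_conjTranspose]
    simp [← Real.sqrt_mul_self_eq_abs]
  have hP := nonneg_iff_posSemidef.mp (CFC.sqrt_nonneg (N * Nᴴ))
  have hPP : CFC.sqrt (N * Nᴴ) * CFC.sqrt (N * Nᴴ) = N * Nᴴ :=
    CFC.sqrt_mul_sqrt_self _ hQ.nonneg
  set P := CFC.sqrt (N * Nᴴ)
  have hU : (N⁻¹ * P) * star (N⁻¹ * P) = 1 := by
    rw [star_eq_conjTranspose, conjTranspose_mul, hP.1.eq]
    calc N⁻¹ * P * (P * (N⁻¹)ᴴ) = N⁻¹ * (P * P) * (N⁻¹)ᴴ := by simp only [mul_assoc]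
      _ = (N⁻¹ * N) * (N⁻¹ * N)ᴴ := by rw [hPP, conjTranspose_mul]; simp only [mul_assoc]
      _ = 1 := by rw [nonsing_inv_mul _ hN]; simp
  refine ⟨P, N⁻¹ * P, hP, ⟨mul_eq_one_comm.mp hU, hU⟩, ?_, hdet⟩
  rw [← mul_assoc, mul_nonsing_inv _ hN, one_mul]

/-! ### Ellipsoids and positive semidefinite matrices -/

theorem det_toEuclideanCLM (A : Matrix n n ℝ) :
    LinearMap.det (toEuclideanCLM (n := n) (𝕜 := ℝ) A : EuclideanSpace ℝ n →ₗ[ℝ] _) = A.det := by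
  rw [coe_toEuclideanCLM_eq_toEuclideanLin, toEuclideanLin_eq_toLin_orthonormal,
    LinearMap.det_toLin]

end Matrix

section Ellipsoid

variable {d : ℕ}

/-- The reciprocal of the volume of the Euclidean unit ball: the absolute value of the determinant
of an affine map that takes the unit ball to an ellipsoid of volume `1`. -/
noncomputable def unitDet (d : ℕ) : ℝ :=
  (volume (Metric.closedBall (0 : EuclideanSpace ℝ (Fin d)) 1)).toReal⁻¹

theorem toReal_volume_closedBall_pos (d : ℕ) :
    0 < (volume (Metric.closedBall (0 : EuclideanSpace ℝ (Fin d)) 1)).toReal :=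
  ENNReal.toReal_pos (Metric.measure_closedBall_pos volume _ one_pos).ne'
    measure_closedBall_lt_top.ne

theorem unitDet_pos (d : ℕ) : 0 < unitDet d :=
  inv_pos.mpr (toReal_volume_closedBall_pos d)

theorem volume_affine_image_eq_one_iff
    (T : EuclideanSpace ℝ (Fin d) →ₗ[ℝ] EuclideanSpace ℝ (Fin d)) (b : EuclideanSpace ℝ (Fin d)) :
    volume ((fun x => T x + b) '' Metric.closedBall 0 1) = 1 ↔ |LinearMap.det T| = unitDet d := by
  have h : (fun x => T x + b) '' Metric.closedBall 0 1 =
      (fun x => x + b) '' (T '' Metric.closedBall 0 1) := by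
    rw [Set.image_image]
  rw [h, Set.image_add_right, measure_preimage_add_right, Measure.addHaar_image_linearMap,
    ← ENNReal.toReal_eq_one_iff, ENNReal.toReal_mul, ENNReal.toReal_ofReal (abs_nonneg _), unitDet,
    mul_eq_one_iff_eq_inv₀ (toReal_volume_closedBall_pos d).ne']

/-- The linear part of an ellipsoid can be taken positive semidefinite: the unitary factor of its
polar decomposition preserves the unit ball. -/
theorem ContainsUnitVolumeEllipsoid.exists_posSemidef {K : Set (EuclideanSpace ℝ (Fin d))}
    (hK : ContainsUnitVolumeEllipsoid K) :
    ∃ (P : Matrix (Fin d) (Fin d) ℝ) (b : EuclideanSpace ℝ (Fin d)),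
      P.PosSemidef ∧ P.det = unitDet d ∧
        ∀ x ∈ Metric.closedBall 0 1, Matrix.toEuclideanCLM (𝕜 := ℝ) P x + b ∈ K := by
  obtain ⟨E, ⟨A, rfl⟩, hvol, hsub⟩ := hK
  have hA : ∀ x, A x = (A.linear : _ →ₗ[ℝ] _) x + A 0 := fun x => by
    simpa using A.map_vadd 0 x
  set N : Matrix (Fin d) (Fin d) ℝ :=
    (Matrix.toEuclideanCLM (𝕜 := ℝ)).symm
      (LinearMap.toContinuousLinearMap (A.linear : _ →ₗ[ℝ] _)) with hN
  have hNA : ∀ x, Matrix.toEuclideanCLM (𝕜 := ℝ) N x = A.linear x := fun x => by simp [hN]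
  have hdet : LinearMap.det (A.linear : EuclideanSpace ℝ (Fin d) →ₗ[ℝ] _) = N.det := by
    rw [← Matrix.det_toEuclideanCLM]
    congr 1
    ext1 x
    exact (hNA x).symm
  have hNdet : |N.det| = unitDet d := by
    rw [← hdet, ← volume_affine_image_eq_one_iff _ (A 0), ← hvol]
    exact congrArg _ (Set.image_congr fun x _ => (hA x).symm)
  have hNu : IsUnit N.det := by
    rw [isUnit_iff_ne_zero]
    intro h
    have := unitDet_pos d
    rw [h, abs_zero] at hNdet
    exact this.ne hNdet
  obtain ⟨P, U, hP, hU, hPU, hPdet⟩ := Matrix.exists_posSemidef_eq_mul_unitary hNu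
  refine ⟨P, A 0, hP, hPdet.trans hNdet, fun x hx => hsub ?_⟩
  refine ⟨Matrix.toEuclideanCLM (𝕜 := ℝ) U x, ?_, ?_⟩
  · have hU' := Unitary.map_mem (Matrix.toEuclideanCLM (n := Fin d) (𝕜 := ℝ)) hU
    simpa [ContinuousLinearMap.norm_map_of_mem_unitary hU'] using hx
  · rw [hA, hPU, map_mul]
    simp [hNA]

/-- An ellipsoid of too large a volume is shrunk towards its centre. -/
theorem containsUnitVolumeEllipsoid_of_unitDet_le (hd : d ≠ 0)
    {K : Set (EuclideanSpace ℝ (Fin d))} {P : Matrix (Fin d) (Fin d) ℝ}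
    {b : EuclideanSpace ℝ (Fin d)} (hP : unitDet d ≤ P.det)
    (hK : ∀ x ∈ Metric.closedBall 0 1, Matrix.toEuclideanCLM (𝕜 := ℝ) P x + b ∈ K) :
    ContainsUnitVolumeEllipsoid K := by
  have hc := unitDet_pos d
  have hP0 : 0 < P.det := hc.trans_le hP
  -- Scaling by `t` multiplies the volume by `t ^ d`.
  set t : ℝ := (unitDet d / P.det) ^ (d⁻¹ : ℝ) with ht
  have htd : t ^ d = unitDet d / P.det := Real.rpow_inv_natCast_pow (by positivity) hd
  have ht0 : 0 ≤ t := by positivity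
  have ht1 : t ≤ 1 := Real.rpow_le_one (by positivity) (div_le_one_of_le₀ hP hP0.le) (by positivity)
  set T : EuclideanSpace ℝ (Fin d) →ₗ[ℝ] EuclideanSpace ℝ (Fin d) :=
    (Matrix.toEuclideanCLM (n := Fin d) (𝕜 := ℝ) (t • P)).toLinearMap with hT
  have hTdet : LinearMap.det T = unitDet d := by
    rw [hT, Matrix.det_toEuclideanCLM, Matrix.det_smul, Fintype.card_fin, htd,
      div_mul_cancel₀ _ hP0.ne']
  let L := LinearEquiv.ofIsUnitDet (f := T) (v := (EuclideanSpace.basisFun (Fin d) ℝ).toBasis)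
    (v' := (EuclideanSpace.basisFun (Fin d) ℝ).toBasis)
    (by rw [LinearMap.det_toMatrix, hTdet]; exact hc.ne'.isUnit)
  have hL : ∀ x, L x = T x := fun x => rfl
  let A : EuclideanSpace ℝ (Fin d) ≃ᵃ[ℝ] EuclideanSpace ℝ (Fin d) :=
    L.toAffineEquiv.trans (AffineEquiv.constVAdd ℝ _ b)
  have hA : (A : EuclideanSpace ℝ (Fin d) → _) = fun x => T x + b := by
    funext x
    simp [A, hL, add_comm]
  refine ⟨A '' Metric.closedBall 0 1, ⟨A, rfl⟩, ?_, ?_⟩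
  · rw [hA, volume_affine_image_eq_one_iff, hTdet, abs_of_pos hc]
  · rintro _ ⟨x, hx, rfl⟩
    have h : A x = Matrix.toEuclideanCLM (𝕜 := ℝ) P (t • x) + b := by
      rw [hA, hT]; simp
    rw [h]
    refine hK _ ?_
    rw [mem_closedBall_zero_iff] at hx ⊢
    rw [norm_smul, Real.norm_of_nonneg ht0]
    exact mul_le_one₀ ht1 (norm_nonneg _) hx

end Ellipsoid

/-! ### The Helly argument -/

section Helly

variable {d : ℕ}

/-- The parameter space of (possibly degenerate) ellipsoids: a symmetric matrix, given by its
values on unordered pairs of indices, and a centre. -/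
abbrev EllipsoidParam (d : ℕ) : Type :=
  (Sym2 (Fin d) → ℝ) × EuclideanSpace ℝ (Fin d)

theorem finrank_ellipsoidParam (d : ℕ) :
    Module.finrank ℝ (EllipsoidParam d) = d * (d + 3) / 2 := by
  rw [Module.finrank_prod, Module.finrank_fintype_fun_eq_card, finrank_euclideanSpace_fin,
    Sym2.card, Fintype.card_fin, Nat.choose_two_right, Nat.add_sub_cancel,
    ← Nat.add_mul_div_right _ _ two_pos]
  congr 1
  ring

/-- The parameters of the (possibly degenerate) ellipsoids contained in `K`. -/
def paramsInside (K : Set (EuclideanSpace ℝ (Fin d))) : Set (EllipsoidParam d) :=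
  {p | ∀ x ∈ Metric.closedBall 0 1, Matrix.toEuclideanCLM (𝕜 := ℝ) (Matrix.ofSym2 p.1) x + p.2 ∈ K}

theorem convex_paramsInside {K : Set (EuclideanSpace ℝ (Fin d))} (hK : Convex ℝ K) :
    Convex ℝ (paramsInside K) := by
  intro p hp q hq a b ha hb hab x hx
  have h := hK (hp x hx) (hq x hx) ha hb hab
  convert h using 1
  simp only [Prod.fst_add, Prod.snd_add, Prod.smul_fst, Prod.smul_snd, map_add, map_smul,
    add_apply, smul_apply, smul_add]
  abel

/-- The parameters whose matrix is positive semidefinite and whose ellipsoid has volume at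
least `1`. -/
def largeParams (d : ℕ) : Set (EllipsoidParam d) :=
  {p | (Matrix.ofSym2 p.1).PosSemidef ∧ unitDet d ≤ (Matrix.ofSym2 p.1).det}

theorem convex_largeParams (d : ℕ) : Convex ℝ (largeParams d) :=
  (Matrix.convex_posSemidef_le_det (unitDet_pos d)).linear_preimage
    (Matrix.ofSym2 ∘ₗ LinearMap.fst ℝ _ _)

theorem ContainsUnitVolumeEllipsoid.exists_mem_largeParams {K : Set (EuclideanSpace ℝ (Fin d))}
    (hK : ContainsUnitVolumeEllipsoid K) : ∃ p ∈ largeParams d, p ∈ paramsInside K := by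
  obtain ⟨P, b, hP, hdet, hsub⟩ := hK.exists_posSemidef
  obtain ⟨f, rfl⟩ := hP.1.exists_ofSym2_eq
  exact ⟨(f, b), ⟨hP, hdet.ge⟩, hsub⟩

theorem ContainsUnitVolumeEllipsoid.nonempty {K : Set (EuclideanSpace ℝ (Fin d))}
    (hK : ContainsUnitVolumeEllipsoid K) : K.Nonempty := by
  obtain ⟨P, b, -, -, hsub⟩ := hK.exists_posSemidef
  exact ⟨_, hsub 0 (by simp)⟩

end Helly

theorem mainTheorem4 (d : ℕ) (hd : 1 ≤ d) {ι : Type*} [Fintype ι]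
    (C : ι → Set (EuclideanSpace ℝ (Fin d)))
    (hconv : ∀ i, Convex ℝ (C i))
    (hcard : d * (d + 3) / 2 ≤ Fintype.card ι)
    (hsel : ∀ s : Finset ι, s.card = d * (d + 3) / 2 →
      ContainsUnitVolumeEllipsoid (⋂ i ∈ s, C i)) :
    ContainsUnitVolumeEllipsoid (⋂ i, C i) := by
  classical
  have hdim : d + 1 ≤ d * (d + 3) / 2 := by
    rw [Nat.le_div_iff_mul_le two_pos]
    nlinarith
  -- Helly's theorem in `ℝ^d` gives a common point of all the sets.
  obtain ⟨z, hz⟩ : (⋂ i ∈ (Finset.univ : Finset ι), C i).Nonempty := by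
    refine Convex.helly_theorem' (𝕜 := ℝ) (fun i _ => hconv i) fun I _ hI => ?_
    rw [finrank_euclideanSpace_fin] at hI
    obtain ⟨J, hIJ, hJ⟩ := Finset.exists_superset_card_eq (hI.trans hdim) hcard
    exact (hsel J hJ).nonempty.mono (Set.biInter_mono hIJ fun _ _ => subset_rfl)
  -- The index `none` stands for the volume condition.
  let F : Option ι → Set (EllipsoidParam d) :=
    fun o => o.elim (largeParams d) fun i => paramsInside (C i)
  obtain ⟨p, hp⟩ : (⋂ o ∈ (Finset.univ : Finset (Option ι)), F o).Nonempty := by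
    refine Convex.helly_theorem (𝕜 := ℝ) ?_ ?_ fun I _ hI => ?_
    · rw [finrank_ellipsoidParam, Finset.card_univ, Fintype.card_option]
      lia
    · rintro (_ | i) -
      exacts [convex_largeParams d, convex_paramsInside (hconv i)]
    rw [finrank_ellipsoidParam] at hI
    by_cases hnone : none ∈ I
    · have hcardI : I.eraseNone.card = d * (d + 3) / 2 := by
        rw [Finset.card_eraseNone_of_mem hnone, hI, Nat.add_sub_cancel]
      obtain ⟨p, hp, hpI⟩ := (hsel _ hcardI).exists_mem_largeParams
      refine ⟨p, Set.mem_iInter₂.mpr ?_⟩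
      rintro (_ | i) hi
      · exact hp
      · exact fun x hx => Set.mem_iInter₂.mp (hpI x hx) i (Finset.mem_eraseNone.mpr hi)
    · -- Without the volume condition the one-point ellipsoid `{z}` will do.
      refine ⟨(0, z), Set.mem_iInter₂.mpr ?_⟩
      rintro (_ | i) hi
      · exact absurd hi hnone
      · intro x _
        simpa using Set.mem_iInter₂.mp hz i (Finset.mem_univ i)
  rw [Set.mem_iInter₂] at hp
  have hlarge : p ∈ largeParams d := hp none (Finset.mem_univ _)
  refine containsUnitVolumeEllipsoid_of_unitDet_le (by lia) (b := p.2) hlarge.2 fun x hx =>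
    Set.mem_iInter.mpr fun i => ?_
  exact hp (some i) (Finset.mem_univ _) x hx
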